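/- Let $X$ be a complex Banach space and let $A:D(A)\subset X\to X$ be the infinitesimal generator of a $C_0$-semigroup $T(t)$, $t\ge 0$, on $X$. For a norm-continuous bounded $B:\mathbb R\to L(X)$, a (mild) solution of $\dot y=Ay+B(t)y$ on $[s,\infty)$ is a continuous $y:[s,\infty)\to X$ with $y(t)=T(t-s)y(s)+\int_s^tT(t-u)B(u)y(u)\,du$ for $t\ge s$. The system is called asymptotically stable if its zero solution is stable and attractive, uniformly in the initial time: for every $\varepsilon>0$ there is $\eta>0$ such that $\|y(s)\|<\eta$ implies $\|y(t)\|<\varepsilon$ for all $s\in\mathbb R$, all solutions $y$ on $[s,\infty)$ and all $t\ge s$; and there is $\eta>0$ such that for every $\varepsilon>0$ there is $\tau>0$ with $\|y(t)\|<\varepsilon$ whenever $\|y(s)\|<\eta$ and $t\ge s+\tau$, for all $s$ and all solutions $y$ on $[s,\infty)$. A separated decomposition of the spectrum of $A$ consists of a bounded closed set $\sigma_1\subset\sigma(A)$ such that $\sigma_2=\sigma(A)\setminus\sigma_1$ is closed in $\mathbb C$, and a positively oriented simple closed $C^1$ curve $\Gamma$ with $\sigma_1$ in its interior and $\sigma_2$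 in its exterior. Put $$P_1=\frac1{2\pi i}\oint_\Gamma(\lambda-A)^{-1}\,d\lambda ,\qquad P_2=I-P_1 .$$ (i) For every separated decomposition, $P_1X\subset D(A)$, $AP_1$ is a bounded operator, and $P_1Ax=AP_1x$ for $x\in D(A)$; so $P_1A$ extends to the bounded operator $AP_1$ on $X$. (ii) Suppose that $\dot x=Ax$ is asymptotically stable, and let $K,\alpha,\mu,M\in\mathbb R$ with $\mu>\alpha$. Then there are $\delta_0>0$ and $h_0>0$, depending only on $T,K,\alpha,\mu,M$, such that the following holds for all $0<\delta\le\delta_0$ and $h\ge h_0$. Consider a separated decomposition with $$\|T(t)P_1\|\le Ke^{-\alpha t},\qquad \|T(t)P_2\|\le Ke^{-\mu t}\qquad(t\ge0),$$ and a norm-continuous $B:\mathbb R\to L(X)$ with $\|B(t)\|\le M$ and $\|P_2B(t)\|\le M\delta$ for all $t\in\mathbb R$. Let $C_t(u)=\int_t^uB(\tau)\,d\tau$ and suppose that for all $t\in\mathbb R$ and $t\le u\le t+h$ $$\|P_1C_t(u)B(u)\|\le M\delta,\qquad \|P_1AC_t(u)\|\le M\delta,\qquad \|P_1C_t(u)A\|\le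 M\delta ,$$ where $P_1A$ in the second condition denotes the bounded operator $AP_1$, and the third condition means $\|P_1C_t(u)Ax\|\le M\delta\|x\|$ for $x\in D(A)$. Then for all $s\in\mathbb R$, $x\in X$ the system $\dot y=Ay+B(t)y$ has a solution on $[s,\infty)$ with $y(s)=x$, and this system is asymptotically stable. -/

import Mathlib

open Set Filter Topology

namespace Semigroups

noncomputable section

section Curves

/-- The point set of a curve parametrised by `[0, 1]`. -/
def trace (γ : ℝ → ℂ) : Set ℂ := γ '' Icc 0 1

/-- The interior of a closed curve: points off the curve whose component in the complement of the
curve is bounded. -/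
def curveInterior (γ : ℝ → ℂ) : Set ℂ :=
  {z | z ∉ trace γ ∧ Bornology.IsBounded (connectedComponentIn (trace γ)ᶜ z)}

/-- The exterior of a closed curve: points off the curve whose component in the complement of the
curve is unbounded. -/
def curveExterior (γ : ℝ → ℂ) : Set ℂ :=
  {z | z ∉ trace γ ∧ ¬ Bornology.IsBounded (connectedComponentIn (trace γ)ᶜ z)}

/-- The winding number `(2πi)⁻¹ ∮ (w - z)⁻¹ dw`. -/
def windingNumber (γ : ℝ → ℂ) (z : ℂ) : ℂ :=
  (2 * Real.pi * Complex.I)⁻¹ * ∫ t in (0 : ℝ)..1, deriv γ t * (γ t - z)⁻¹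

/-- A positively oriented simple closed `C¹` curve. -/
structure IsPositiveJordanCurve (γ : ℝ → ℂ) : Prop where
  contDiffOn : ContDiffOn ℝ 1 γ (Icc 0 1)
  closed : γ 0 = γ 1
  simple : InjOn γ (Ico 0 1)
  positive : ∀ z ∈ curveInterior γ, windingNumber γ z = 1

end Curves

variable {X : Type*} [NormedAddCommGroup X] [NormedSpace ℂ X]

section Operators

/-- `R` is the bounded two-sided inverse of `z - A : D(A) → X`. -/
def IsResolventAt (A : X →ₗ.[ℂ] X) (z : ℂ) (R : X →L[ℂ] X) : Prop :=
  (∀ x : X, ∃ hx : R x ∈ A.domain, z • R x - A ⟨R x, hx⟩ = x) ∧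
    ∀ x : A.domain, R (z • (x : X) - A x) = x

/-- The spectrum of the (possibly unbounded) operator `A`. -/
def spec (A : X →ₗ.[ℂ] X) : Set ℂ := {z | ¬ ∃ R : X →L[ℂ] X, IsResolventAt A z R}

open Classical in
/-- The resolvent `(z - A)⁻¹`; by convention `0` for `z` in the spectrum. -/
def resolv (A : X →ₗ.[ℂ] X) (z : ℂ) : X →L[ℂ] X :=
  if h : ∃ R : X →L[ℂ] X, IsResolventAt A z R then h.choose else 0

/-- The Riesz projection `(2πi)⁻¹ ∮ (z - A)⁻¹ dz` along the curve `γ`. -/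
def rieszProj (A : X →ₗ.[ℂ] X) (γ : ℝ → ℂ) : X →L[ℂ] X :=
  (2 * Real.pi * Complex.I : ℂ)⁻¹ • ∫ t in (0 : ℝ)..1, deriv γ t • resolv A (γ t)

/-- `σ₁` is a bounded spectral set of `A`, separated by the positively oriented curve `γ` from the
remainder `σ₂ = σ(A) \ σ₁`. -/
structure IsSeparated (A : X →ₗ.[ℂ] X) (σ₁ : Set ℂ) (γ : ℝ → ℂ) : Prop where
  subset : σ₁ ⊆ spec A
  bounded : Bornology.IsBounded σ₁
  isClosed_fst : IsClosed σ₁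
  isClosed_snd : IsClosed (spec A \ σ₁)
  curve : IsPositiveJordanCurve γ
  fst_interior : σ₁ ⊆ curveInterior γ
  snd_exterior : spec A \ σ₁ ⊆ curveExterior γ

/-- `A L` is everywhere defined and `‖A L‖ ≤ c`. -/
def NormCompLeftLE (A : X →ₗ.[ℂ] X) (L : X →L[ℂ] X) (c : ℝ) : Prop :=
  ∀ x : X, ∃ hx : L x ∈ A.domain, ‖A ⟨L x, hx⟩‖ ≤ c * ‖x‖

/-- `L A`, defined on `D(A)`, satisfies `‖L A‖ ≤ c`. -/
def NormCompRightLE (A : X →ₗ.[ℂ] X) (L : X →L[ℂ] X) (c : ℝ) : Prop :=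
  ∀ x : A.domain, ‖L (A x)‖ ≤ c * ‖(x : X)‖

end Operators

section Evolution

/-- `T(t)`, `t ≥ 0`, is a `C₀`-semigroup; the values at `t < 0` are irrelevant. -/
structure IsC0Semigroup (T : ℝ → X →L[ℂ] X) : Prop where
  zero : T 0 = ContinuousLinearMap.id ℂ X
  add : ∀ s t : ℝ, 0 ≤ s → 0 ≤ t → T (s + t) = (T s).comp (T t)
  continuousOn : ∀ x : X, ContinuousOn (fun t => T t x) (Ici 0)

/-- `A` is the infinitesimal generator of `T`, with its maximal domain. -/
structure IsGenerator (T : ℝ → X →L[ℂ] X) (A : X →ₗ.[ℂ] X) : Prop where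
  mem_domain : ∀ x : X, x ∈ A.domain ↔
    ∃ y : X, Tendsto (fun t : ℝ => t⁻¹ • (T t x - x)) (𝓝[>] 0) (𝓝 y)
  tendsto : ∀ x : A.domain,
    Tendsto (fun t : ℝ => t⁻¹ • (T t (x : X) - x)) (𝓝[>] 0) (𝓝 (A x))

/-- `y` is a (mild) solution on `[s, ∞)` of `y' = A y + B(t) y`, where `A` generates `T`: the
variation of constants formula holds. -/
structure IsSolution (T B : ℝ → X →L[ℂ] X) (s : ℝ) (y : ℝ → X) : Prop where
  continuousOn : ContinuousOn y (Ici s)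
  formula : ∀ t, s ≤ t → y t = T (t - s) (y s) + ∫ u in s..t, T (t - u) (B u (y u))

/-- The linear system `y' = A y + B(t) y`, where `A` generates `T`, is asymptotically stable:
the zero solution is stable and attractive, uniformly in the initial time. -/
structure IsAsympStable (T B : ℝ → X →L[ℂ] X) : Prop where
  stable : ∀ ε > 0, ∃ η > 0, ∀ (s : ℝ) (y : ℝ → X), IsSolution T B s y → ‖y s‖ < η →
    ∀ t, s ≤ t → ‖y t‖ < ε
  attractive : ∃ η > 0, ∀ ε > 0, ∃ τ > 0, ∀ (s : ℝ) (y : ℝ → X), IsSolution T B s y → ‖y s‖ < η →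
    ∀ t, s + τ ≤ t → ‖y t‖ < ε

/-- `C_t(u) = ∫_t^u B(τ) dτ`. -/
def primitive (B : ℝ → X →L[ℂ] X) (t u : ℝ) : X →L[ℂ] X := ∫ τ in t..u, B τ

end Evolution

end

end Semigroups

/-!
Part (i) is the identity `A (z - A)⁻¹ = z (z - A)⁻¹ - 1`, integrated along the curve.

For part (ii), let `P` be the projection, let `y` be a solution starting at time `s`, and put
`G(u) = P ∫_s^u B`. Since `G' = P B` and `A G`, `G A`, `G B` are small, `G y` almost solves
`v' = A v + P B y`; so `∫_s^t T(t - u) P B(u) y(u) du` is close to `G(t) y(t)`, which is itself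
small: if `‖T(h)‖ ≤ 1/2`, then `‖G‖ ≤ 2 ‖G (1 - T(h))‖`, and `1 - T(h)` is `A` applied to a bounded
operator. As `(1 - P) B` is small anyway, `y` stays close to the unperturbed orbit over a time `h`
in which `T` contracts, so `y` contracts as well, and it decays by iteration.
-/

namespace Semigroups

section Resolvent

variable {X : Type*} [NormedAddCommGroup X] [NormedSpace ℂ X] {A : X →ₗ.[ℂ] X} {z w : ℂ}
  {R S : X →L[ℂ] X}

theorem isResolventAt_resolv (hz : z ∉ spec A) : IsResolventAt A z (resolv A z) := by
  have h : ∃ R, IsResolventAt A z R := not_not.1 hz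
  rw [resolv, dif_pos h]
  exact h.choose_spec

theorem IsResolventAt.map_apply (hR : IsResolventAt A z R) (x : X) :
    ∃ hx : R x ∈ A.domain, A ⟨R x, hx⟩ = z • R x - x :=
  (hR.1 x).imp fun _ h => (sub_eq_of_eq_add' (sub_eq_iff_eq_add.1 h)).symm

theorem IsResolventAt.apply_map (hR : IsResolventAt A z R) (x : A.domain) :
    R (A x) = z • R x - x := by
  have h := hR.2 x
  rw [map_sub, map_smul] at h
  exact (sub_eq_of_eq_add' (sub_eq_iff_eq_add.1 h)).symm

theorem IsResolventAt.sub_eq (hR : IsResolventAt A z R) (hS : IsResolventAt A w S) :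
    R - S = (w - z) • S * R := by
  ext x
  obtain ⟨hx, hAR⟩ := hR.map_apply x
  have hSA := hS.apply_map ⟨R x, hx⟩
  rw [hAR, map_sub, map_smul] at hSA
  change R x - S x = (w - z) • S (R x)
  rw [sub_smul]
  grind

theorem continuousOn_resolv [CompleteSpace X] (A : X →ₗ.[ℂ] X) :
    ContinuousOn (resolv A) (spec A)ᶜ := by
  intro w hw
  let U : ℂ → X →L[ℂ] X := fun z => 1 - (w - z) • resolv A w
  have hU : ContinuousAt U w := by fun_prop
  have hUw : U w = ((1 : (X →L[ℂ] X)ˣ) : X →L[ℂ] X) := by simp [U]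
  have hunit : ∀ᶠ z in 𝓝 w, IsUnit (U z) := by
    have h := Units.nhds (1 : (X →L[ℂ] X)ˣ)
    rw [← hUw] at h
    exact hU.eventually h
  have hinv : ContinuousAt (fun z => Ring.inverse (U z) * resolv A w) w := by
    have h := NormedRing.inverse_continuousAt (1 : (X →L[ℂ] X)ˣ)
    rw [← hUw] at h
    exact (ContinuousAt.comp (g := Ring.inverse) h hU).mul continuousAt_const
  -- The resolvent identity says `(1 - (w - z) R(w)) R(z) = R(w)`.
  have heq : ∀ z, z ∉ spec A → IsUnit (U z) →
      resolv A z = Ring.inverse (U z) * resolv A w := fun z hz hUz => by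
    have hid := (isResolventAt_resolv hz).sub_eq (isResolventAt_resolv hw)
    have : U z * resolv A z = resolv A w := by
      rw [sub_mul, one_mul, ← hid, sub_sub_cancel]
    rw [← this, ← mul_assoc, Ring.inverse_mul_cancel _ hUz, one_mul]
  refine hinv.continuousWithinAt.congr_of_eventuallyEq ?_ (heq w hw hunit.self_of_nhds)
  filter_upwards [self_mem_nhdsWithin, nhdsWithin_le_nhds hunit] with z hz hUz
  exact heq z hz hUz

end Resolvent

section RieszProjection

variable {X : Type*} [NormedAddCommGroup X] [NormedSpace ℂ X] {A : X →ₗ.[ℂ] X} {γ : ℝ → ℂ}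

theorem IsSeparated.disjoint_trace_spec {σ₁ : Set ℂ} (h : IsSeparated A σ₁ γ) :
    Disjoint (trace γ) (spec A) := by
  refine disjoint_left.2 fun z hz hzA => ?_
  by_cases hz₁ : z ∈ σ₁
  · exact (h.fst_interior hz₁).1 hz
  · exact (h.snd_exterior ⟨hzA, hz₁⟩).1 hz

theorem notMem_spec_of_disjoint_trace (hγA : Disjoint (trace γ) (spec A)) {t : ℝ}
    (ht : t ∈ uIcc (0 : ℝ) 1) : γ t ∉ spec A := by
  rw [uIcc_of_le zero_le_one] at ht
  exact disjoint_left.1 hγA (mem_image_of_mem γ ht)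

theorem intervalIntegrable_deriv_of_contDiffOn (h : ContDiffOn ℝ 1 γ (Icc 0 1)) :
    IntervalIntegrable (deriv γ) MeasureTheory.volume 0 1 := by
  have hc : ContinuousOn (derivWithin γ (Icc 0 1)) (Icc 0 1) :=
    h.continuousOn_derivWithin (uniqueDiffOn_Icc zero_lt_one) le_rfl
  refine (hc.intervalIntegrable_of_Icc zero_le_one).congr_uIoo ?_
  rw [uIoo_of_le zero_le_one]
  exact fun t ht => derivWithin_of_mem_nhds (Icc_mem_nhds ht.1 ht.2)

/-- The bounded operator `A P` for the Riesz projection `P` along `γ`: since `A (z - A)⁻¹` is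
`z (z - A)⁻¹ - 1`, it is given by the contour integral of the latter. -/
noncomputable def compRieszProj (A : X →ₗ.[ℂ] X) (γ : ℝ → ℂ) : X →L[ℂ] X :=
  (2 * Real.pi * Complex.I : ℂ)⁻¹ • ∫ t in (0 : ℝ)..1, deriv γ t • (γ t • resolv A (γ t) - 1)

variable [CompleteSpace X] (hγ : ContinuousOn γ (uIcc 0 1))
  (hγ' : IntervalIntegrable (deriv γ) MeasureTheory.volume 0 1)
  (hγA : Disjoint (trace γ) (spec A))

include hγ hγA in
theorem continuousOn_resolv_comp : ContinuousOn (fun t => resolv A (γ t)) (uIcc 0 1) :=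
  (continuousOn_resolv A).comp hγ fun _ => notMem_spec_of_disjoint_trace hγA

include hγ hγ' hγA

theorem intervalIntegrable_rieszProj :
    IntervalIntegrable (fun t => deriv γ t • resolv A (γ t)) MeasureTheory.volume 0 1 :=
  hγ'.smul_continuousOn (continuousOn_resolv_comp hγ hγA)

theorem intervalIntegrable_compRieszProj :
    IntervalIntegrable (fun t => deriv γ t • (γ t • resolv A (γ t) - 1))
      MeasureTheory.volume 0 1 :=
  hγ'.smul_continuousOn ((hγ.smul (continuousOn_resolv_comp hγ hγA)).sub continuousOn_const)

theorem rieszProj_apply_map (x : A.domain) : rieszProj A γ (A x) = compRieszProj A γ x := by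
  have hP := intervalIntegrable_rieszProj hγ hγ' hγA
  have hAP := intervalIntegrable_compRieszProj hγ hγ' hγA
  rw [rieszProj, compRieszProj, smul_apply, smul_apply,
    ContinuousLinearMap.intervalIntegral_apply hP, ContinuousLinearMap.intervalIntegral_apply hAP]
  congr 1
  refine intervalIntegral.integral_congr fun t ht => ?_
  change deriv γ t • resolv A (γ t) (A x) = deriv γ t • (γ t • resolv A (γ t) x - x)
  rw [(isResolventAt_resolv (notMem_spec_of_disjoint_trace hγA ht)).apply_map x]

theorem rieszProj_eq_resolvent_mul {z : ℂ} {S : X →L[ℂ] X} (hS : IsResolventAt A z S) :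
    rieszProj A γ = S * (z • rieszProj A γ - compRieszProj A γ) := by
  let F : ℝ → X →L[ℂ] X := fun t => deriv γ t • resolv A (γ t)
  let G : ℝ → X →L[ℂ] X := fun t => deriv γ t • (γ t • resolv A (γ t) - 1)
  have hG : IntervalIntegrable G MeasureTheory.volume 0 1 :=
    intervalIntegrable_compRieszProj hγ hγ' hγA
  have hF : IntervalIntegrable (fun t => z • F t) MeasureTheory.volume 0 1 :=
    (intervalIntegrable_rieszProj hγ hγ' hγA).smul z
  have hFG : ∀ t ∈ uIcc (0 : ℝ) 1, F t = S * (z • F t - G t) := fun t ht => by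
    have hid := (isResolventAt_resolv (notMem_spec_of_disjoint_trace hγA ht)).sub_eq hS
    rw [sub_smul, sub_mul, smul_mul_assoc, smul_mul_assoc] at hid
    simp only [F, G, smul_comm z, ← smul_sub, mul_smul_comm, mul_sub, mul_one]
    rw [← sub_add, ← hid, sub_add_cancel]
  have hint : ∫ t in (0 : ℝ)..1, F t =
      S * (z • (∫ t in (0 : ℝ)..1, F t) - ∫ t in (0 : ℝ)..1, G t) :=
    calc ∫ t in (0 : ℝ)..1, F t
      _ = ∫ t in (0 : ℝ)..1, S * (z • F t - G t) := intervalIntegral.integral_congr hFG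
      _ = S * ∫ t in (0 : ℝ)..1, (z • F t - G t) :=
        (ContinuousLinearMap.mul ℂ _ S).intervalIntegral_comp_comm (hF.sub hG)
      _ = _ := by rw [intervalIntegral.integral_sub hF hG, intervalIntegral.integral_smul]
  rw [rieszProj, compRieszProj, smul_comm, ← smul_sub, mul_smul_comm, ← hint]

theorem map_rieszProj (x : X) :
    ∃ hx : rieszProj A γ x ∈ A.domain, A ⟨rieszProj A γ x, hx⟩ = compRieszProj A γ x := by
  have hS := isResolventAt_resolv (notMem_spec_of_disjoint_trace hγA left_mem_uIcc)
  have hP : rieszProj A γ x = _ :=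
    congrArg (· x) (rieszProj_eq_resolvent_mul hγ hγ' hγA hS)
  obtain ⟨hx, hA⟩ := hS.map_apply (γ 0 • rieszProj A γ x - compRieszProj A γ x)
  change rieszProj A γ x = resolv A (γ 0) (γ 0 • rieszProj A γ x - compRieszProj A γ x) at hP
  simp only [← hP] at hx hA
  exact ⟨hx, hA.trans (sub_sub_cancel _ _)⟩

end RieszProjection

section Semigroup

variable {X : Type*} [NormedAddCommGroup X] [NormedSpace ℂ X] {T B : ℝ → X →L[ℂ] X}
  {A : X →ₗ.[ℂ] X} {s : ℝ} {y : ℝ → X}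

/-- The semigroup `T` continued by `T(t) = T(0)` to `t < 0`. This makes `(t, x) ↦ T(t) x`
continuous on `ℝ × X`, so that integrals of orbits need no care at the boundary of `[0, ∞)`. -/
def extend (T : ℝ → X →L[ℂ] X) (t : ℝ) : X →L[ℂ] X := T (max t 0)

theorem extend_of_nonneg (T : ℝ → X →L[ℂ] X) {t : ℝ} (ht : 0 ≤ t) : extend T t = T t := by
  rw [extend, max_eq_left ht]

theorem IsC0Semigroup.extend (hT : IsC0Semigroup T) : IsC0Semigroup (extend T) where
  zero := (extend_of_nonneg T le_rfl).trans hT.zero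
  add s t hs ht := by
    simpa only [extend_of_nonneg T, hs, ht, add_nonneg] using hT.add s t hs ht
  continuousOn x := (hT.continuousOn x).congr fun t ht => by rw [extend_of_nonneg T ht]

theorem IsC0Semigroup.continuous_extend (hT : IsC0Semigroup T) {C : ℝ}
    (hC : ∀ t, 0 ≤ t → ‖T t‖ ≤ C) :
    Continuous fun p : ℝ × X => Semigroups.extend T p.1 p.2 :=
  continuous_prod_of_continuous_lipschitzWith' _ ⟨C, (norm_nonneg _).trans (hC 0 le_rfl)⟩
    (fun t => ContinuousLinearMap.lipschitzWith_of_opNorm_le (f := Semigroups.extend T t)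
      (hC _ (le_max_right t 0)))
    fun x => (hT.continuousOn x).comp_continuous (by fun_prop) fun t => le_max_right t 0

theorem IsGenerator.extend (hA : IsGenerator T A) : IsGenerator (extend T) A := by
  have h (x : X) : (fun t : ℝ => t⁻¹ • (Semigroups.extend T t x - x)) =ᶠ[𝓝[>] 0]
      fun t : ℝ => t⁻¹ • (T t x - x) := by
    filter_upwards [self_mem_nhdsWithin] with t ht
    rw [extend_of_nonneg T (le_of_lt ht)]
  exact ⟨fun x => by simpa only [tendsto_congr' (h x)] using hA.mem_domain x,
    fun x => by simpa only [tendsto_congr' (h (x : X))] using hA.tendsto x⟩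

theorem isSolution_extend_iff : IsSolution (extend T) B s y ↔ IsSolution T B s y := by
  have h (t : ℝ) (ht : s ≤ t) :
      extend T (t - s) (y s) + (∫ u in s..t, extend T (t - u) (B u (y u))) =
        T (t - s) (y s) + ∫ u in s..t, T (t - u) (B u (y u)) := by
    rw [extend_of_nonneg T (sub_nonneg.2 ht)]
    congr 1
    refine intervalIntegral.integral_congr fun u hu => ?_
    rw [uIcc_of_le ht] at hu
    rw [extend_of_nonneg T (sub_nonneg.2 hu.2)]
  exact ⟨fun hy => ⟨hy.1, fun t ht => (hy.2 t ht).trans (h t ht)⟩,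
    fun hy => ⟨hy.1, fun t ht => (hy.2 t ht).trans (h t ht).symm⟩⟩

theorem IsSolution.comp_max (hy : IsSolution T B s y) :
    IsSolution T B s fun t => y (max t s) := by
  refine ⟨hy.1.congr fun t ht => by rw [max_eq_left ht], fun t ht => ?_⟩
  simp only [max_eq_left ht, max_self]
  rw [hy.2 t ht]
  congr 1
  refine intervalIntegral.integral_congr fun u hu => ?_
  rw [uIcc_of_le ht] at hu
  rw [max_eq_left hu.1]

theorem IsSolution.continuous_comp_max (hy : IsSolution T B s y) :
    Continuous fun t => y (max t s) :=
  hy.1.comp_continuous (by fun_prop) fun t => le_max_right t s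

theorem IsC0Semigroup.zero_apply (hT : IsC0Semigroup T) (x : X) : T 0 x = x := by
  rw [hT.zero, ContinuousLinearMap.id_apply]

theorem IsC0Semigroup.add_apply (hT : IsC0Semigroup T) {r t : ℝ} (hr : 0 ≤ r) (ht : 0 ≤ t)
    (x : X) : T (r + t) x = T r (T t x) := by
  rw [hT.add r t hr ht, ContinuousLinearMap.comp_apply]

theorem tendsto_average {E : Type*} [NormedAddCommGroup E] [NormedSpace ℝ E] [CompleteSpace E]
    {g : ℝ → ℝ → E} (hg : Continuous fun p : ℝ × ℝ => g p.1 p.2) (u : ℝ) :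
    Tendsto (fun k : ℝ => k⁻¹ • ∫ r in u..u + k, g k r) (𝓝[>] 0) (𝓝 (g 0 u)) := by
  have hc : Continuous fun k : ℝ => ∫ r in (0 : ℝ)..1, g k (u + k * r) :=
    intervalIntegral.continuous_parametric_intervalIntegral_of_continuous'
      (by exact hg.comp (by fun_prop : Continuous fun p : ℝ × ℝ => (p.1, u + p.1 * p.2))) 0 1
  have hlim := (hc.tendsto 0).mono_left (nhdsWithin_le_nhds (s := Ioi 0))
  simp only [zero_mul, add_zero, intervalIntegral.integral_const, sub_zero, one_smul] at hlim
  refine hlim.congr' ?_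
  filter_upwards [self_mem_nhdsWithin] with k hk
  rw [intervalIntegral.integral_comp_add_mul (g k) (ne_of_gt hk), mul_zero, add_zero, mul_one]

variable [CompleteSpace X] (hT : IsC0Semigroup T)
  (hcont : Continuous fun p : ℝ × X => T p.1 p.2)

include hT hcont

theorem IsC0Semigroup.apply_integral_orbit {k h : ℝ} (hk : 0 ≤ k) (hh : 0 ≤ h) (x : X) :
    T k (∫ r in (0 : ℝ)..h, T r x) = ∫ r in k..k + h, T r x := by
  have hx : Continuous fun r => T r x := hcont.comp (by fun_prop : Continuous fun r => (r, x))
  rw [← (T k).intervalIntegral_comp_comm (hx.intervalIntegrable 0 h)]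
  have hshift := intervalIntegral.integral_comp_add_left (a := 0) (b := h) (fun r => T r x) k
  rw [add_zero] at hshift
  rw [← hshift]
  refine intervalIntegral.integral_congr fun r hr => ?_
  rw [uIcc_of_le hh] at hr
  exact (hT.add_apply hk hr.1 x).symm

theorem IsGenerator.map_integral_orbit (hA : IsGenerator T A) (x : X) {h : ℝ} (hh : 0 ≤ h) :
    ∃ hx : (∫ r in (0 : ℝ)..h, T r x) ∈ A.domain,
      A ⟨∫ r in (0 : ℝ)..h, T r x, hx⟩ = T h x - x := by
  have hx : Continuous fun r => T r x := hcont.comp (by fun_prop : Continuous fun r => (r, x))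
  have hi (a b : ℝ) : IntervalIntegrable (fun r => T r x) MeasureTheory.volume a b :=
    hx.intervalIntegrable a b
  have hd (t : ℝ) : HasDerivAt (fun t => ∫ r in (0 : ℝ)..t, T r x) (T t x) t :=
    (hx.integral_hasStrictDerivAt 0 t).hasDerivAt
  have hlim : Tendsto (fun t : ℝ => t⁻¹ • (T t (∫ r in (0 : ℝ)..h, T r x) -
      ∫ r in (0 : ℝ)..h, T r x)) (𝓝[>] 0) (𝓝 (T h x - x)) := by
    have hdiff := (hd h).tendsto_slope_zero_right.sub (hd 0).tendsto_slope_zero_right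
    rw [hT.zero_apply] at hdiff
    refine hdiff.congr' ?_
    filter_upwards [self_mem_nhdsWithin] with k hk
    rw [← smul_sub, hT.apply_integral_orbit hcont (le_of_lt hk) hh, zero_add,
      intervalIntegral.integral_same, sub_zero, add_comm h k,
      ← intervalIntegral.integral_add_adjacent_intervals (hi 0 k) (hi k (k + h))]
    congr 1
    abel
  have hmem : (∫ r in (0 : ℝ)..h, T r x) ∈ A.domain := (hA.mem_domain _).2 ⟨_, hlim⟩
  exact ⟨hmem, tendsto_nhds_unique (hA.tendsto ⟨_, hmem⟩) hlim⟩

theorem IsSolution.restart (hB : Continuous B) (hyc : Continuous y) (hy : IsSolution T B s y)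
    {r : ℝ} (hsr : s ≤ r) : IsSolution T B r y := by
  refine ⟨hyc.continuousOn, fun t hrt => ?_⟩
  have hi (c a b : ℝ) : IntervalIntegrable (fun u => T (c - u) (B u (y u)))
      MeasureTheory.volume a b :=
    (hcont.comp (by fun_prop : Continuous fun u : ℝ => (c - u, B u (y u)))).intervalIntegrable a b
  have hsplit {u : ℝ} (hur : u ≤ r) (x : X) : T (t - r) (T (r - u) x) = T (t - u) x := by
    rw [← hT.add_apply (sub_nonneg.2 hrt) (sub_nonneg.2 hur), sub_add_sub_cancel]
  have hpast : T (t - r) (∫ u in s..r, T (r - u) (B u (y u))) =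
      ∫ u in s..r, T (t - u) (B u (y u)) := by
    rw [← (T (t - r)).intervalIntegral_comp_comm (hi r s r)]
    refine intervalIntegral.integral_congr fun u hu => ?_
    rw [uIcc_of_le hsr] at hu
    exact hsplit hu.2 _
  rw [hy.2 t (hsr.trans hrt), hy.2 r hsr, map_add, hsplit hsr, hpast, add_assoc,
    intervalIntegral.integral_add_adjacent_intervals (hi t s r) (hi t r t)]

end Semigroup

section RightRate

variable {E : Type*} [NormedAddCommGroup E] {δ δ' : ℝ → E} {c c' : ℝ}

/-- `limsup_{k → 0+} ‖δ(k)‖ / k ≤ c`: a bound for the upper right derivative at `0` of a function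
vanishing there. It avoids `limsup`, which has a junk value on unbounded real functions. -/
def RightRateLE (δ : ℝ → E) (c : ℝ) : Prop := ∀ ρ > c, ∀ᶠ k in 𝓝[>] 0, ‖δ k‖ ≤ ρ * k

theorem RightRateLE.mono (h : RightRateLE δ c) (hc : c ≤ c') : RightRateLE δ c' :=
  fun ρ hρ => h ρ (hc.trans_lt hρ)

theorem RightRateLE.of_norm_le (h : RightRateLE δ c) (hδ : ∀ᶠ k in 𝓝[>] 0, ‖δ' k‖ ≤ ‖δ k‖) :
    RightRateLE δ' c := fun ρ hρ => by
  filter_upwards [h ρ hρ, hδ] with k hk hk' using hk'.trans hk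

theorem RightRateLE.add (h : RightRateLE δ c) (h' : RightRateLE δ' c') :
    RightRateLE (fun k => δ k + δ' k) (c + c') := fun ρ hρ => by
  have hη : 0 < (ρ - (c + c')) / 2 := by linarith
  filter_upwards [h _ (lt_add_of_pos_right c hη), h' _ (lt_add_of_pos_right c' hη)] with k hk hk'
  calc ‖δ k + δ' k‖
    _ ≤ _ := (norm_add_le _ _).trans (add_le_add hk hk')
    _ = ρ * k := by ring

theorem RightRateLE.sub (h : RightRateLE δ c) (h' : RightRateLE δ' c') :
    RightRateLE (fun k => δ k - δ' k) (c + c') := by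
  simpa only [sub_eq_add_neg] using
    h.add (h'.of_norm_le (.of_forall fun k => (norm_neg (δ' k)).le))

theorem rightRateLE_of_tendsto [NormedSpace ℝ E] {l : E}
    (h : Tendsto (fun k : ℝ => k⁻¹ • δ k) (𝓝[>] 0) (𝓝 l)) :
    RightRateLE δ ‖l‖ := fun ρ hρ => by
  filter_upwards [h.norm.eventually_lt_const hρ, self_mem_nhdsWithin] with k hk hk0
  rw [norm_smul, norm_inv, Real.norm_of_nonneg (le_of_lt hk0), inv_mul_eq_div] at hk
  exact ((div_lt_iff₀ hk0).1 hk).le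

theorem RightRateLE.clm_apply {𝕜 F : Type*} [NontriviallyNormedField 𝕜] [NormedSpace 𝕜 E]
    [NormedAddCommGroup F] [NormedSpace 𝕜 F] {L : ℝ → E →L[𝕜] F} {C : ℝ}
    (h : RightRateLE δ c) (hL : ∀ k, ‖L k‖ ≤ C) :
    RightRateLE (fun k => L k (δ k)) (C * c) := fun ρ hρ => by
  have hlt : ∀ᶠ r in 𝓝 c, C * r < ρ :=
    ((continuous_const_mul C).tendsto c).eventually_lt_const hρ
  obtain ⟨r, hr, hcr⟩ :=
    ((hlt.filter_mono nhdsWithin_le_nhds).and (self_mem_nhdsWithin (s := Ioi c))).exists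
  filter_upwards [h r hcr, self_mem_nhdsWithin] with k hk hk0
  calc ‖L k (δ k)‖
    _ ≤ C * (r * k) := (L k).le_of_opNorm_le_of_le (hL k) hk
    _ = C * r * k := (mul_assoc _ _ _).symm
    _ ≤ ρ * k := mul_le_mul_of_nonneg_right hr.le (le_of_lt hk0)

theorem norm_sub_le_of_rightRateLE {s t : ℝ} (hst : s ≤ t) (hδ : ContinuousOn δ (Icc s t))
    (h : ∀ u ∈ Ico s t, RightRateLE (fun k => δ (u + k) - δ u) c) :
    ‖δ t - δ s‖ ≤ c * (t - s) := by
  refine image_le_of_liminf_slope_right_le_deriv_boundary (f := fun u => ‖δ u - δ s‖)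
    (B := fun u => c * (u - s)) (B' := fun _ => c) (hδ.sub continuousOn_const).norm (by simp)
    (by fun_prop)
    (fun u _ => by
      simpa using (((hasDerivAt_id u).sub_const s).const_mul c).hasDerivWithinAt)
    (fun u hu ρ hρ => Eventually.frequently ?_) ⟨hst, le_rfl⟩
  obtain ⟨r, hcr, hrρ⟩ := exists_between hρ
  have hmap : map (fun k => u + k) (𝓝[>] (0 : ℝ)) = 𝓝[>] u := by simp
  rw [← hmap, eventually_map]
  filter_upwards [h u hu r hcr, self_mem_nhdsWithin] with k hk hk0
  rw [slope_def_field, add_sub_cancel_left]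
  refine lt_of_le_of_lt ((div_le_iff₀ hk0).2 (le_trans ?_ hk)) hrρ
  simpa using norm_sub_norm_le (δ (u + k) - δ s) (δ u - δ s)

end RightRate

section Averaging

variable {X : Type*} [NormedAddCommGroup X] [NormedSpace ℂ X] [CompleteSpace X]
  {T : ℝ → X →L[ℂ] X} {A : X →ₗ.[ℂ] X} {C a : ℝ} (hT : IsC0Semigroup T)
  (hcont : Continuous fun p : ℝ × X => T p.1 p.2)

include hT hcont

theorem norm_sub_mild_le_of_rightRateLE (hC : ∀ r, ‖T r‖ ≤ C) {v g : ℝ → X} {s t c : ℝ}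
    (hst : s ≤ t) (hv : Continuous v) (hg : Continuous g)
    (h : ∀ u ∈ Ico s t, RightRateLE (fun k => v (u + k) - T k (v u) - k • g u) c) :
    ‖v t - T (t - s) (v s) - ∫ r in s..t, T (t - r) (g r)‖ ≤ C * c * (t - s) := by
  have hTg : Continuous fun r => T (t - r) (g r) :=
    hcont.comp (by fun_prop : Continuous fun r => (t - r, g r))
  let I : ℝ → X := fun u => ∫ r in s..u, T (t - r) (g r)
  have hI (u : ℝ) : HasDerivAt I (T (t - u) (g u)) u :=
    (hTg.integral_hasStrictDerivAt s u).hasDerivAt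
  let D : ℝ → X := fun u => T (t - u) (v u) - I u
  have hD : Continuous D :=
    (hcont.comp (by fun_prop : Continuous fun u => (t - u, v u))).sub
      (continuous_iff_continuousAt.2 fun u => (hI u).continuousAt)
  suffices hrate : ∀ u ∈ Ico s t, RightRateLE (fun k => D (u + k) - D u) (C * c) by
    have hle := norm_sub_le_of_rightRateLE hst hD.continuousOn hrate
    simp only [D, I, sub_self, hT.zero_apply, intervalIntegral.integral_same, sub_zero] at hle
    rwa [sub_right_comm] at hle
  intro u hu
  have hlim : Tendsto (fun k : ℝ => k⁻¹ • (T (t - (u + k)) (k • g u) - (I (u + k) - I u)))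
      (𝓝[>] 0) (𝓝 0) := by
    have hTgu : Continuous fun k : ℝ => T (t - (u + k)) (g u) :=
      hcont.comp (by fun_prop : Continuous fun k : ℝ => (t - (u + k), g u))
    have hdiff := ((hTgu.tendsto 0).mono_left (nhdsWithin_le_nhds (s := Ioi 0))).sub
      (hI u).tendsto_slope_zero_right
    simp only [add_zero, sub_self] at hdiff
    refine hdiff.congr' ?_
    filter_upwards [self_mem_nhdsWithin] with k hk
    rw [ContinuousLinearMap.map_smul_of_tower, smul_sub k⁻¹ (k • _),
      inv_smul_smul₀ (ne_of_gt (mem_Ioi.1 hk))]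
  have hsum := ((h u hu).clm_apply fun k => hC (t - (u + k))).add (rightRateLE_of_tendsto hlim)
  rw [norm_zero, add_zero] at hsum
  refine hsum.of_norm_le ?_
  filter_upwards [Ioo_mem_nhdsGT (sub_pos.2 hu.2)] with k hk
  have hsplit : T (t - u) (v u) = T (t - (u + k)) (T k (v u)) := by
    rw [← hT.add_apply (by linarith [hk.2]) hk.1.le, ← sub_sub, sub_add_cancel]
  refine (congrArg norm ?_).le
  simp only [D, hsplit, map_sub]
  abel

theorem NormCompRightLE.norm_apply_sub_le {G : X →L[ℂ] X} (hG : NormCompRightLE A G a)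
    (hA : IsGenerator T A) {h : ℝ} (hh : 0 ≤ h) (x : X) :
    ‖G (T h x - x)‖ ≤ a * ‖∫ r in (0 : ℝ)..h, T r x‖ := by
  obtain ⟨hx, hAx⟩ := hA.map_integral_orbit hT hcont x hh
  rw [← hAx]
  exact hG ⟨_, hx⟩

theorem NormCompRightLE.norm_le {G : X →L[ℂ] X} (hG : NormCompRightLE A G a)
    (hA : IsGenerator T A) (hC : ∀ r, ‖T r‖ ≤ C) (ha : 0 ≤ a) {h : ℝ} (hh : 0 ≤ h)
    (hTh : ‖T h‖ ≤ 1 / 2) : ‖G‖ ≤ 2 * (a * (C * h)) := by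
  have hC0 : 0 ≤ C := (norm_nonneg _).trans (hC 0)
  suffices ‖G‖ ≤ a * (C * h) + ‖G‖ * (1 / 2) by linarith
  refine G.opNorm_le_bound (by positivity) fun x => ?_
  have hint : ‖∫ r in (0 : ℝ)..h, T r x‖ ≤ C * ‖x‖ * |h - 0| :=
    intervalIntegral.norm_integral_le_of_norm_le_const fun r _ => (T r).le_of_opNorm_le (hC r) x
  rw [sub_zero, abs_of_nonneg hh] at hint
  calc ‖G x‖
    _ = ‖G (T h x) - G (T h x - x)‖ := by rw [map_sub, sub_sub_cancel]
    _ ≤ ‖G (T h x)‖ + ‖G (T h x - x)‖ := norm_sub_le _ _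
    _ ≤ ‖G‖ * (1 / 2 * ‖x‖) + a * (C * ‖x‖ * h) :=
      add_le_add (G.le_opNorm_of_le ((T h).le_of_opNorm_le hTh x))
        ((hG.norm_apply_sub_le hT hcont hA hh x).trans (mul_le_mul_of_nonneg_left hint ha))
    _ = (a * (C * h) + ‖G‖ * (1 / 2)) * ‖x‖ := by ring

theorem rightRateLE_clm_apply_sub {G : ℝ → X →L[ℂ] X} (hA : IsGenerator T A)
    (hG : ∀ᶠ k in 𝓝[>] 0, NormCompRightLE A (G k) a) (x : X) :
    RightRateLE (fun k => G k (T k x - x)) ‖a • x‖ := by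
  have hlim : Tendsto (fun k : ℝ => k⁻¹ • ∫ r in (0 : ℝ)..0 + k, T r x) (𝓝[>] 0) (𝓝 (T 0 x)) :=
    tendsto_average (g := fun _ r => T r x)
      (hcont.comp (by fun_prop : Continuous fun p : ℝ × ℝ => (p.2, x))) 0
  simp only [zero_add, hT.zero_apply] at hlim
  have hlim' : Tendsto (fun k : ℝ => k⁻¹ • a • ∫ r in (0 : ℝ)..k, T r x) (𝓝[>] 0)
      (𝓝 (a • x)) := by
    simpa only [smul_comm a] using hlim.const_smul a
  refine (rightRateLE_of_tendsto hlim').of_norm_le ?_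
  filter_upwards [hG, self_mem_nhdsWithin] with k hGk hk
  refine (hGk.norm_apply_sub_le hT hcont hA (le_of_lt hk) x).trans ?_
  rw [norm_smul]
  exact mul_le_mul_of_nonneg_right (le_abs_self a) (norm_nonneg _)

theorem rightRateLE_clm_apply_integral {G : ℝ → X →L[ℂ] X} {u : ℝ} (hG : ContinuousAt G u)
    {f : ℝ → X} (hf : Continuous f) :
    RightRateLE (fun k => G (u + k) (∫ r in u..u + k, T (u + k - r) (f r))) ‖G u (f u)‖ := by
  have hint : Tendsto (fun k : ℝ => k⁻¹ • ∫ r in u..u + k, T (u + k - r) (f r)) (𝓝[>] 0)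
      (𝓝 (f u)) := by
    have h := tendsto_average (g := fun k r => T (u + k - r) (f r))
      (hcont.comp (by fun_prop : Continuous fun p : ℝ × ℝ => (u + p.1 - p.2, f p.2))) u
    simpa only [add_zero, sub_self, hT.zero_apply] using h
  have hGu : Tendsto (fun k : ℝ => G (u + k)) (𝓝[>] 0) (𝓝 (G u)) := by
    have h : Tendsto (fun k : ℝ => u + k) (𝓝[>] 0) (𝓝 u) := by
      simpa using ((continuous_const_add u).tendsto 0).mono_left (nhdsWithin_le_nhds (s := Ioi 0))
    exact hG.tendsto.comp h
  have heval : Continuous fun p : (X →L[ℂ] X) × X => p.1 p.2 := by fun_prop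
  refine rightRateLE_of_tendsto (((heval.tendsto (G u, f u)).comp
    (hGu.prodMk_nhds hint)).congr fun k => ?_)
  exact (G (u + k)).map_smul_of_tower _ _

/-- If `G' = Q`, then formally `(G y)' = A (G y) + Q y + (G A - A G) y + G f` along `y' = A y + f`.
So `G y` solves `v' = A v + Q y` up to errors that are small together with `A G`, `G A`, `G f`. -/
theorem rightRateLE_clm_apply_mild (hA : IsGenerator T A) (ha : 0 ≤ a) {G : ℝ → X →L[ℂ] X}
    {Q : X →L[ℂ] X} {f y : ℝ → X} {u : ℝ} (hG : HasDerivAt G Q u) (hf : Continuous f)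
    (hy : ∀ k, 0 ≤ k → y (u + k) = T k (y u) + ∫ r in u..u + k, T (u + k - r) (f r))
    (hl : NormCompLeftLE A (G u) a) (hr : ∀ᶠ k in 𝓝[>] 0, NormCompRightLE A (G (u + k)) a) :
    RightRateLE (fun k => G (u + k) (y (u + k)) - T k (G u (y u)) - k • Q (y u))
      (2 * a * ‖y u‖ + ‖G u (f u)‖) := by
  obtain ⟨hdom, hAle⟩ := hl (y u)
  have hQ : Tendsto (fun k : ℝ => k⁻¹ • ((G (u + k) - G u) (y u) - k • Q (y u))) (𝓝[>] 0)
      (𝓝 0) := by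
    have hslope := ((ContinuousLinearMap.apply ℂ X (y u)).continuous.tendsto _).comp
      hG.tendsto_slope_zero_right
    refine (sub_self (Q (y u)) ▸ hslope.sub_const (Q (y u))).congr' ?_
    filter_upwards [self_mem_nhdsWithin] with k hk
    rw [smul_sub k⁻¹, inv_smul_smul₀ (ne_of_gt (mem_Ioi.1 hk))]
    rfl
  have hsum := (((rightRateLE_of_tendsto hQ).add
    (rightRateLE_clm_apply_integral hT hcont hG.continuousAt hf)).add
    (rightRateLE_clm_apply_sub hT hcont hA hr (y u))).sub
    (rightRateLE_of_tendsto (hA.tendsto ⟨G u (y u), hdom⟩))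
  refine (hsum.mono ?_).of_norm_le ?_
  · rw [norm_zero, norm_smul, Real.norm_of_nonneg ha]
    linarith
  filter_upwards [self_mem_nhdsWithin] with k hk
  refine (congrArg norm ?_).le
  rw [hy k (le_of_lt hk)]
  simp only [map_add, map_sub, _root_.sub_apply]
  abel

theorem norm_clm_apply_sub_integral_le (hA : IsGenerator T A) (hC : ∀ r, ‖T r‖ ≤ C) (ha : 0 ≤ a)
    {B G Q : ℝ → X →L[ℂ] X} {y : ℝ → X} {s t b N : ℝ} (hst : s ≤ t) (hB : Continuous B)
    (hyc : Continuous y) (hy : IsSolution T B s y) (hG : ∀ u, HasDerivAt G (Q u) u)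
    (hQ : Continuous Q) (hGs : G s = 0) (hl : ∀ u ∈ Icc s t, NormCompLeftLE A (G u) a)
    (hr : ∀ u ∈ Icc s t, NormCompRightLE A (G u) a)
    (hb : ∀ u ∈ Icc s t, ‖G u (B u (y u))‖ ≤ b) (hN : ∀ u ∈ Icc s t, ‖y u‖ ≤ N) :
    ‖G t (y t) - ∫ u in s..t, T (t - u) (Q u (y u))‖ ≤ C * (2 * a * N + b) * (t - s) := by
  have hGc : Continuous G := continuous_iff_continuousAt.2 fun u => (hG u).continuousAt
  have hmild := norm_sub_mild_le_of_rightRateLE hT hcont hC (v := fun u => G u (y u))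
    (g := fun u => Q u (y u)) hst (by fun_prop) (by fun_prop) (c := 2 * a * N + b) ?_
  · simpa only [hGs, _root_.zero_apply, map_zero, sub_zero] using hmild
  intro u hu
  have hu' : u ∈ Icc s t := Ico_subset_Icc_self hu
  have hyu (k : ℝ) (hk : 0 ≤ k) :
      y (u + k) = T k (y u) + ∫ r in u..u + k, T (u + k - r) (B r (y r)) := by
    simpa only [add_sub_cancel_left] using
      (hy.restart hT hcont hB hyc hu.1).2 (u + k) (le_add_of_nonneg_right hk)
  have hru : ∀ᶠ k in 𝓝[>] 0, NormCompRightLE A (G (u + k)) a := by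
    filter_upwards [Ioo_mem_nhdsGT (sub_pos.2 hu.2)] with k hk
    exact hr _ ⟨by linarith [hu.1, hk.1], by linarith [hk.2]⟩
  refine (rightRateLE_clm_apply_mild hT hcont hA ha (hG u) (by fun_prop) hyu (hl u hu')
    hru).mono ?_
  exact add_le_add (mul_le_mul_of_nonneg_left (hN u hu') (by positivity)) (hb u hu')

end Averaging

section SmallAverages

variable {X : Type*} [NormedAddCommGroup X] [NormedSpace ℂ X] {A : X →ₗ.[ℂ] X}

theorem NormCompLeftLE.mono {L : X →L[ℂ] X} {c c' : ℝ} (h : NormCompLeftLE A L c) (hc : c ≤ c') :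
    NormCompLeftLE A L c' := fun x =>
  (h x).imp fun _ hx => hx.trans (mul_le_mul_of_nonneg_right hc (norm_nonneg x))

theorem NormCompRightLE.mono {L : X →L[ℂ] X} {c c' : ℝ} (h : NormCompRightLE A L c)
    (hc : c ≤ c') : NormCompRightLE A L c' := fun x =>
  (h x).trans (mul_le_mul_of_nonneg_right hc (norm_nonneg (x : X)))

/-- The perturbation `B` is `ε`-small on the range of `1 - P`, while on the range of `P` its
integrals over time intervals of length at most `h` are `ε`-small, even after multiplication by
`B` from the right or by `A` from either side. -/
structure SmallAverages (A : X →ₗ.[ℂ] X) (P : X →L[ℂ] X) (B : ℝ → X →L[ℂ] X) (h ε : ℝ) :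
    Prop where
  compl : ∀ t, ‖(ContinuousLinearMap.id ℂ X - P).comp (B t)‖ ≤ ε
  comp : ∀ t u, t ≤ u → u ≤ t + h → ‖(P.comp (primitive B t u)).comp (B u)‖ ≤ ε
  generator_comp : ∀ t u, t ≤ u → u ≤ t + h → NormCompLeftLE A (P.comp (primitive B t u)) ε
  comp_generator : ∀ t u, t ≤ u → u ≤ t + h → NormCompRightLE A (P.comp (primitive B t u)) ε

variable {P : X →L[ℂ] X} {T B : ℝ → X →L[ℂ] X} {h ε : ℝ}

theorem SmallAverages.nonneg (H : SmallAverages A P B h ε) : 0 ≤ ε :=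
  (norm_nonneg _).trans (H.compl 0)

theorem SmallAverages.mono {h' ε' : ℝ} (H : SmallAverages A P B h ε) (hh : h' ≤ h)
    (hε : ε ≤ ε') : SmallAverages A P B h' ε' where
  compl t := (H.compl t).trans hε
  comp t u htu hu := (H.comp t u htu (by linarith)).trans hε
  generator_comp t u htu hu := (H.generator_comp t u htu (by linarith)).mono hε
  comp_generator t u htu hu := (H.comp_generator t u htu (by linarith)).mono hε

variable {C s N : ℝ} {y : ℝ → X}

theorem IsSolution.sub_eq_integral_add_integral (hy : IsSolution T B s y)
    (hcont : Continuous fun p : ℝ × X => T p.1 p.2) (hB : Continuous B) (hyc : Continuous y)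
    (P : X →L[ℂ] X) {t : ℝ} (hst : s ≤ t) :
    y t - T (t - s) (y s) = (∫ u in s..t, T (t - u) (P.comp (B u) (y u))) +
      ∫ u in s..t, T (t - u) ((ContinuousLinearMap.id ℂ X - P).comp (B u) (y u)) := by
  have hi (L : X →L[ℂ] X) : IntervalIntegrable (fun u => T (t - u) (L.comp (B u) (y u)))
      MeasureTheory.volume s t :=
    (hcont.comp (by fun_prop : Continuous fun u : ℝ =>
      (t - u, L.comp (B u) (y u)))).intervalIntegrable s t
  rw [← intervalIntegral.integral_add (hi P) (hi _), hy.2 t hst, add_sub_cancel_left]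
  refine intervalIntegral.integral_congr fun u _ => ?_
  simp only [← map_add, ContinuousLinearMap.comp_apply, _root_.sub_apply,
    ContinuousLinearMap.id_apply, add_sub_cancel]

variable [CompleteSpace X]

theorem hasDerivAt_primitive (hB : Continuous B) (s u : ℝ) :
    HasDerivAt (primitive B s) (B u) u :=
  (hB.integral_hasStrictDerivAt s u).hasDerivAt

variable (hT : IsC0Semigroup T) (hcont : Continuous fun p : ℝ × X => T p.1 p.2)
  (hC : ∀ r, ‖T r‖ ≤ C) (hA : IsGenerator T A) (hB : Continuous B) (hyc : Continuous y)
  (H : SmallAverages A P B h ε)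

include hT hcont hC hA hB hyc H

theorem SmallAverages.norm_integral_le (hh : 0 ≤ h) (hTh : ‖T h‖ ≤ 1 / 2)
    (hy : IsSolution T B s y) (hN : ∀ u ∈ Icc s (s + h), ‖y u‖ ≤ N) {t : ℝ}
    (ht : t ∈ Icc s (s + h)) :
    ‖∫ u in s..t, T (t - u) (P.comp (B u) (y u))‖ ≤ 5 * (C * h * ε) * N := by
  have hC0 : 0 ≤ C := (norm_nonneg _).trans (hC 0)
  have hε := H.nonneg
  have hN0 : 0 ≤ N := (norm_nonneg _).trans (hN t ht)
  have hsub {u : ℝ} (hu : u ∈ Icc s t) : u ∈ Icc s (s + h) := ⟨hu.1, hu.2.trans ht.2⟩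
  let G : ℝ → X →L[ℂ] X := fun u => P.comp (primitive B s u)
  have hG (u : ℝ) : HasDerivAt G (P.comp (B u)) u :=
    ((ContinuousLinearMap.compL ℂ X X X P).restrictScalars ℝ).hasFDerivAt.comp_hasDerivAt u
      (hasDerivAt_primitive hB s u)
  have hdiff : ‖G t (y t) - ∫ u in s..t, T (t - u) (P.comp (B u) (y u))‖ ≤
      C * (2 * ε * N + ε * N) * (t - s) :=
    norm_clm_apply_sub_integral_le hT hcont hA hC hε ht.1 hB hyc hy hG (by fun_prop)
      (by simp only [G, primitive, intervalIntegral.integral_same, ContinuousLinearMap.comp_zero])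
      (fun u hu => H.generator_comp s u hu.1 (hsub hu).2)
      (fun u hu => H.comp_generator s u hu.1 (hsub hu).2)
      (fun u hu => ((G u).comp (B u)).le_of_opNorm_le_of_le (H.comp s u hu.1 (hsub hu).2)
        (hN u (hsub hu))) fun u hu => hN u (hsub hu)
  have hGt : ‖G t (y t)‖ ≤ 2 * (ε * (C * h)) * N :=
    (G t).le_of_opNorm_le_of_le
      ((H.comp_generator s t ht.1 ht.2).norm_le hT hcont hA hC hε hh hTh) (hN t ht)
  have hth : C * (2 * ε * N + ε * N) * (t - s) ≤ C * (2 * ε * N + ε * N) * h :=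
    mul_le_mul_of_nonneg_left (by linarith [ht.2]) (by positivity)
  calc ‖∫ u in s..t, T (t - u) (P.comp (B u) (y u))‖
    _ ≤ ‖G t (y t)‖ + ‖G t (y t) - ∫ u in s..t, T (t - u) (P.comp (B u) (y u))‖ := by
      simpa using norm_sub_le (G t (y t)) (G t (y t) - ∫ u in s..t, T (t - u) (P.comp (B u) (y u)))
    _ ≤ 2 * (ε * (C * h)) * N + C * (2 * ε * N + ε * N) * h := add_le_add hGt (hdiff.trans hth)
    _ = 5 * (C * h * ε) * N := by ring

theorem SmallAverages.norm_sub_le (hh : 0 ≤ h) (hTh : ‖T h‖ ≤ 1 / 2) (hy : IsSolution T B s y)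
    (hN : ∀ u ∈ Icc s (s + h), ‖y u‖ ≤ N) {t : ℝ} (ht : t ∈ Icc s (s + h)) :
    ‖y t - T (t - s) (y s)‖ ≤ 6 * (C * h * ε) * N := by
  have hC0 : 0 ≤ C := (norm_nonneg _).trans (hC 0)
  have hε := H.nonneg
  have hN0 : 0 ≤ N := (norm_nonneg _).trans (hN t ht)
  have hcompl : ‖∫ u in s..t, T (t - u) ((ContinuousLinearMap.id ℂ X - P).comp (B u) (y u))‖ ≤
      C * (ε * N) * |t - s| := by
    refine intervalIntegral.norm_integral_le_of_norm_le_const fun u hu => ?_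
    rw [uIoc_of_le ht.1] at hu
    exact (T (t - u)).le_of_opNorm_le_of_le (hC _) (ContinuousLinearMap.le_of_opNorm_le_of_le _
      (H.compl u) (hN u ⟨hu.1.le, hu.2.trans ht.2⟩))
  rw [abs_of_nonneg (sub_nonneg.2 ht.1)] at hcompl
  have hth : C * (ε * N) * (t - s) ≤ C * (ε * N) * h :=
    mul_le_mul_of_nonneg_left (by linarith [ht.2]) (by positivity)
  rw [hy.sub_eq_integral_add_integral hcont hB hyc P ht.1]
  calc _ ≤ 5 * (C * h * ε) * N + C * (ε * N) * h :=
        norm_add_le_of_le (H.norm_integral_le hT hcont hC hA hB hyc hh hTh hy hN ht)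
          (hcompl.trans hth)
    _ = 6 * (C * h * ε) * N := by ring

theorem SmallAverages.norm_solution_le (hC1 : 1 ≤ C) (hh : 0 ≤ h) (hTh : ‖T h‖ ≤ 1 / 4)
    (hsmall : 6 * (C * h * ε) * (8 * C) ≤ 1) (hy : IsSolution T B s y) :
    (∀ t ∈ Icc s (s + h), ‖y t‖ ≤ 2 * C * ‖y s‖) ∧ ‖y (s + h)‖ ≤ 1 / 2 * ‖y s‖ := by
  have hε := H.nonneg
  obtain ⟨m, hm, hmax⟩ := isCompact_Icc.exists_isMaxOn
    (nonempty_Icc.2 (le_add_of_nonneg_right hh)) hyc.norm.continuousOn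
  have hN (u : ℝ) (hu : u ∈ Icc s (s + h)) : ‖y u‖ ≤ ‖y m‖ := hmax hu
  have hfree (t : ℝ) (ht : t ∈ Icc s (s + h)) :
      ‖y t‖ ≤ 6 * (C * h * ε) * ‖y m‖ + ‖T (t - s) (y s)‖ := by
    have := H.norm_sub_le hT hcont hC hA hB hyc hh (hTh.trans (by norm_num)) hy hN ht
    linarith [norm_sub_norm_le (y t) (T (t - s) (y s))]
  set κ := 6 * (C * h * ε)
  have hκ0 : 0 ≤ κ := by positivity
  have hκ : κ ≤ 1 / 2 := by nlinarith
  have hbound : ‖y m‖ ≤ 2 * C * ‖y s‖ := by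
    have := hfree m hm
    have := (T (m - s)).le_of_opNorm_le (hC _) (y s)
    have := mul_le_mul_of_nonneg_right hκ (norm_nonneg (y m))
    linarith
  refine ⟨fun t ht => (hN t ht).trans hbound, ?_⟩
  have hend := hfree (s + h) ⟨le_add_of_nonneg_right hh, le_rfl⟩
  rw [add_sub_cancel_left] at hend
  calc ‖y (s + h)‖
    _ ≤ κ * (2 * C * ‖y s‖) + 1 / 4 * ‖y s‖ :=
      hend.trans (add_le_add (mul_le_mul_of_nonneg_left hbound hκ0)
        ((T h).le_of_opNorm_le hTh (y s)))
    _ = (κ * (8 * C) + 1) / 4 * ‖y s‖ := by ring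
    _ ≤ 1 / 2 * ‖y s‖ := mul_le_mul_of_nonneg_right (by linarith) (norm_nonneg _)

end SmallAverages

section Stability

theorem opNorm_le_of_norm_lt {𝕜 E F : Type*} [RCLike 𝕜] [SeminormedAddCommGroup E]
    [NormedSpace 𝕜 E] [SeminormedAddCommGroup F] [NormedSpace 𝕜 F] {L : E →L[𝕜] F} {η ε : ℝ}
    (hη : 0 < η) (hε : 0 ≤ ε) (h : ∀ x, ‖x‖ < η → ‖L x‖ ≤ ε) : ‖L‖ ≤ 2 * ε / η := by
  have hhalf : ‖(2⁻¹ : 𝕜)‖ = 2⁻¹ := by rw [norm_inv, RCLike.norm_ofNat]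
  refine ContinuousLinearMap.opNorm_le_of_shell' hη (by positivity) (c := (2⁻¹ : 𝕜))
    (by rw [hhalf]; norm_num) fun x hxη hx => (h x hx).trans ?_
  rw [hhalf] at hxη
  rw [div_mul_eq_mul_div, le_div_iff₀ hη]
  nlinarith

theorem norm_add_nat_mul_le_of_contraction {E : Type*} [Norm E] {y : ℝ → E} {s h q : ℝ}
    (hh : 0 ≤ h) (hq : 0 ≤ q) (H : ∀ r, s ≤ r → ‖y (r + h)‖ ≤ q * ‖y r‖) (n : ℕ) :
    ‖y (s + n * h)‖ ≤ q ^ n * ‖y s‖ := by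
  induction n with
  | zero => simp
  | succ n ih =>
    calc ‖y (s + (n + 1 : ℕ) * h)‖
      _ = ‖y (s + n * h + h)‖ := by rw [Nat.cast_succ, add_one_mul, add_assoc]
      _ ≤ q * ‖y (s + n * h)‖ := H _ (le_add_of_nonneg_right (by positivity))
      _ ≤ q * (q ^ n * ‖y s‖) := mul_le_mul_of_nonneg_left ih hq
      _ = q ^ (n + 1) * ‖y s‖ := by ring

theorem norm_le_mul_pow_of_contraction {E : Type*} [SeminormedAddGroup E] {y : ℝ → E}
    {s h q C : ℝ} (hh : 0 < h) (hq : 0 ≤ q) (hq1 : q ≤ 1) (hC : 0 ≤ C)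
    (H : ∀ r, s ≤ r → (∀ t ∈ Icc r (r + h), ‖y t‖ ≤ C * ‖y r‖) ∧ ‖y (r + h)‖ ≤ q * ‖y r‖)
    {m : ℕ} {t : ℝ} (ht : s + m * h ≤ t) : ‖y t‖ ≤ C * (q ^ m * ‖y s‖) := by
  have hm : (m : ℝ) ≤ (t - s) / h := (le_div_iff₀ hh).2 (by linarith)
  let n := ⌊(t - s) / h⌋₊
  have hn : s + n * h ≤ t := by
    have := (le_div_iff₀ hh).1 (Nat.floor_le (m.cast_nonneg.trans hm))
    linarith
  have hn' : t ≤ s + n * h + h := by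
    have := (div_lt_iff₀ hh).1 (Nat.lt_floor_add_one ((t - s) / h))
    linarith
  have hsn : s ≤ s + n * h := le_add_of_nonneg_right (by positivity)
  calc ‖y t‖
    _ ≤ C * ‖y (s + n * h)‖ := (H _ hsn).1 t ⟨hn, hn'⟩
    _ ≤ C * (q ^ n * ‖y s‖) := mul_le_mul_of_nonneg_left
      (norm_add_nat_mul_le_of_contraction hh.le hq (fun r hr => (H r hr).2) n) hC
    _ ≤ C * (q ^ m * ‖y s‖) := by
      gcongr ?_ * (?_ * _)
      exact pow_le_pow_of_le_one hq hq1 (Nat.le_floor hm)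

variable {X : Type*} [NormedAddCommGroup X] [NormedSpace ℂ X] {T B : ℝ → X →L[ℂ] X}

theorem isAsympStable_of_contraction {h q C : ℝ} (hh : 0 < h) (hq : 0 ≤ q) (hq1 : q < 1)
    (hC : 0 < C)
    (H : ∀ s y, IsSolution T B s y → ∀ r, s ≤ r →
      (∀ t ∈ Icc r (r + h), ‖y t‖ ≤ C * ‖y r‖) ∧ ‖y (r + h)‖ ≤ q * ‖y r‖) :
    IsAsympStable T B where
  stable ε hε := by
    refine ⟨ε / C, by positivity, fun s y hy hys t ht => ?_⟩
    have hbound := norm_le_mul_pow_of_contraction (m := 0) (t := t) hh hq hq1.le hC.le (H s y hy)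
      (by simpa using ht)
    rw [pow_zero, one_mul] at hbound
    exact hbound.trans_lt ((lt_div_iff₀' hC).1 hys)
  attractive := by
    refine ⟨1, one_pos, fun ε hε => ?_⟩
    obtain ⟨m, hm⟩ := exists_pow_lt_of_lt_one (div_pos hε hC) hq1
    refine ⟨(m + 1) * h, by positivity, fun s y hy hys t ht => ?_⟩
    calc ‖y t‖
      _ ≤ C * (q ^ m * ‖y s‖) :=
        norm_le_mul_pow_of_contraction hh hq hq1.le hC.le (H s y hy) (by linarith)
      _ ≤ C * (q ^ m * 1) := by gcongr
      _ < ε := by rwa [mul_one, ← lt_div_iff₀' hC]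

theorem IsC0Semigroup.isSolution_zero (hT : IsC0Semigroup T) (x : X) :
    IsSolution T (fun _ => 0) 0 fun t => T t x where
  continuousOn := hT.continuousOn x
  formula t _ := by simp [hT.zero]

theorem IsAsympStable.exists_norm_le (hT : IsC0Semigroup T) (hS : IsAsympStable T fun _ => 0) :
    ∃ C, 1 ≤ C ∧ ∀ t, 0 ≤ t → ‖T t‖ ≤ C := by
  obtain ⟨η, hη, H⟩ := hS.stable 1 one_pos
  refine ⟨max 1 (2 * 1 / η), le_max_left _ _, fun t ht =>
    (opNorm_le_of_norm_lt hη zero_le_one fun x hx => ?_).trans (le_max_right _ _)⟩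
  exact (H 0 _ (hT.isSolution_zero x) (by rwa [hT.zero_apply]) t ht).le

theorem IsAsympStable.exists_norm_le_of_pos (hT : IsC0Semigroup T)
    (hS : IsAsympStable T fun _ => 0) {κ : ℝ} (hκ : 0 < κ) : ∃ τ > 0, ‖T τ‖ ≤ κ := by
  obtain ⟨η, hη, H⟩ := hS.attractive
  obtain ⟨τ, hτ, H⟩ := H (κ * η / 2) (by positivity)
  refine ⟨τ, hτ, (opNorm_le_of_norm_lt hη (by positivity : 0 ≤ κ * η / 2) fun x hx => ?_).trans_eq
    (by field_simp)⟩
  exact (H 0 _ (hT.isSolution_zero x) (by rwa [hT.zero_apply]) τ (by rw [zero_add])).le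

theorem SmallAverages.isAsympStable [CompleteSpace X] {A : X →ₗ.[ℂ] X} {P : X →L[ℂ] X}
    {h ε C : ℝ} (H : SmallAverages A P B h ε) (hT : IsC0Semigroup T) (hA : IsGenerator T A)
    (hC : ∀ t, 0 ≤ t → ‖T t‖ ≤ C) (hC1 : 1 ≤ C) (hB : Continuous B) (hh : 0 < h)
    (hTh : ‖T h‖ ≤ 1 / 4) (hsmall : 6 * (C * h * ε) * (8 * C) ≤ 1) : IsAsympStable T B := by
  refine isAsympStable_of_contraction (q := 1 / 2) (C := 2 * C) hh (by norm_num) (by norm_num)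
    (by linarith) fun s y hy r hsr => ?_
  have hyc := hy.continuous_comp_max
  have hsol := (isSolution_extend_iff.2 hy.comp_max).restart hT.extend (hT.continuous_extend hC)
    hB hyc hsr
  obtain ⟨hbound, hend⟩ := H.norm_solution_le hT.extend (hT.continuous_extend hC)
    (fun r => hC _ (le_max_right r 0)) hA.extend hB hyc hC1 hh.le
    (by rwa [extend_of_nonneg T hh.le]) hsmall hsol
  rw [max_eq_left hsr] at hend hbound
  rw [max_eq_left (by linarith)] at hend
  refine ⟨fun t ht => ?_, hend⟩
  simpa only [max_eq_left (hsr.trans ht.1)] using hbound t ht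

end Stability

section Existence

open MeasureTheory BoundedContinuousFunction

theorem integral_deriv_mul_exp_sub_le_one {φ ψ : ℝ → ℝ} (hφ : ∀ u, HasDerivAt φ (ψ u) u)
    (hψ : Continuous ψ) (s t : ℝ) : ∫ u in s..t, ψ u * Real.exp (φ u - φ t) ≤ 1 := by
  have hφc : Continuous φ := continuous_iff_continuousAt.2 fun u => (hφ u).continuousAt
  have hderiv (u : ℝ) :
      HasDerivAt (fun u => Real.exp (φ u - φ t)) (ψ u * Real.exp (φ u - φ t)) u := by
    simpa only [mul_comm] using ((hφ u).sub_const (φ t)).exp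
  rw [intervalIntegral.integral_eq_sub_of_hasDerivAt (fun u _ => hderiv u)
    ((by fun_prop : Continuous fun u => ψ u * Real.exp (φ u - φ t)).intervalIntegrable s t),
    sub_self, Real.exp_zero]
  exact sub_le_self 1 (Real.exp_nonneg _)

variable {E : Type*} [NormedAddCommGroup E] [NormedSpace ℝ E] {s : ℝ} {f : ℝ → E}
  {k : ℝ → ℝ → E → E}

theorem norm_integral_sub_le_of_lipschitz
    (hk : Continuous fun p : ℝ × ℝ × E => k p.1 p.2.1 p.2.2) {ψ : ℝ → ℝ → ℝ} {q t : ℝ}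
    (hkψ : ∀ u x x', ‖k t u x - k t u x'‖ ≤ ψ t u * ‖x - x'‖) (hψ : Continuous (ψ t))
    (hψ0 : ∀ u, 0 ≤ ψ t u) (hq : ∫ u in s..t, ψ t u ≤ q) (hst : s ≤ t) (z w : ℝ →ᵇ E) :
    ‖(∫ u in s..t, k t u (z u)) - ∫ u in s..t, k t u (w u)‖ ≤ q * dist z w := by
  have hi (z : ℝ →ᵇ E) : IntervalIntegrable (fun u => k t u (z u)) volume s t :=
    (hk.comp (by fun_prop : Continuous fun u => (t, u, z u))).intervalIntegrable s t
  rw [← intervalIntegral.integral_sub (hi z) (hi w)]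
  calc ‖∫ u in s..t, k t u (z u) - k t u (w u)‖
    _ ≤ ∫ u in s..t, ψ t u * dist z w := by
      refine intervalIntegral.norm_integral_le_of_norm_le hst (.of_forall fun u _ => ?_)
        ((hψ.mul_const _).intervalIntegrable s t)
      refine (hkψ u _ _).trans (mul_le_mul_of_nonneg_left ?_ (hψ0 u))
      rw [← dist_eq_norm]
      exact dist_coe_le_dist u
    _ = (∫ u in s..t, ψ t u) * dist z w := intervalIntegral.integral_mul_const _ _
    _ ≤ q * dist z w := mul_le_mul_of_nonneg_right hq dist_nonneg

theorem norm_exp_smul_sub_le {g : E → E} {c : ℝ} (hg : ∀ x x', ‖g x - g x'‖ ≤ c * ‖x - x'‖)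
    (a b : ℝ) (x x' : E) :
    ‖Real.exp (-b) • g (Real.exp a • x) - Real.exp (-b) • g (Real.exp a • x')‖ ≤
      c * Real.exp (a - b) * ‖x - x'‖ := by
  have hx := hg (Real.exp a • x) (Real.exp a • x')
  rw [← smul_sub, norm_smul, Real.norm_of_nonneg (Real.exp_nonneg _)] at hx
  rw [← smul_sub, norm_smul, Real.norm_of_nonneg (Real.exp_nonneg _), sub_eq_add_neg a b,
    Real.exp_add]
  exact (mul_le_mul_of_nonneg_left hx (Real.exp_nonneg _)).trans_eq (by ring)

variable [CompleteSpace E]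

theorem exists_volterra_solution_of_contraction
    (hk : Continuous fun p : ℝ × ℝ × E => k p.1 p.2.1 p.2.2) (hk0 : ∀ t u, k t u 0 = 0)
    {ψ : ℝ → ℝ → ℝ} (hkψ : ∀ t u x x', ‖k t u x - k t u x'‖ ≤ ψ t u * ‖x - x'‖)
    (hψ : ∀ t, Continuous (ψ t)) (hψ0 : ∀ t u, 0 ≤ ψ t u) {q : NNReal} (hq1 : q < 1)
    (hq : ∀ t, s ≤ t → ∫ u in s..t, ψ t u ≤ q)
    (hf : Continuous f) {F : ℝ} (hfF : ∀ t, s ≤ t → ‖f t‖ ≤ F) :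
    ∃ z : ℝ → E, Continuous z ∧ ∀ t, s ≤ t → z t = f t + ∫ u in s..t, k t u (z u) := by
  let V (z : ℝ → E) (t : ℝ) : E := ∫ u in s..max t s, k (max t s) u (z u)
  have hVc (z : ℝ →ᵇ E) : Continuous (V z) :=
    intervalIntegral.continuous_parametric_intervalIntegral_of_continuous
      (f := fun t u => k (max t s) u (z u))
      (by exact hk.comp (by fun_prop : Continuous fun p : ℝ × ℝ => (max p.1 s, p.2, z p.2)))
      (by fun_prop)
  have hV (z w : ℝ →ᵇ E) (t : ℝ) : ‖V z t - V w t‖ ≤ q * dist z w :=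
    norm_integral_sub_le_of_lipschitz hk (hkψ _) (hψ _) (hψ0 _) (hq _ (le_max_right t s))
      (le_max_right t s) z w
  have hV0 (z : ℝ →ᵇ E) (t : ℝ) : ‖V z t‖ ≤ q * ‖z‖ := by
    simpa [V, hk0] using hV z 0 t
  let Φ (z : ℝ →ᵇ E) : ℝ →ᵇ E := ofNormedAddCommGroup (fun t => f (max t s) + V z t)
    ((hf.comp (by fun_prop)).add (hVc z)) (F + q * ‖z‖) fun t =>
      norm_add_le_of_le (hfF _ (le_max_right t s)) (hV0 z t)
  have hΦ : ContractingWith q Φ := by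
    refine ⟨hq1, LipschitzWith.of_dist_le_mul fun z w => (dist_le (by positivity)).2 fun t => ?_⟩
    rw [dist_eq_norm]
    change ‖f (max t s) + V z t - (f (max t s) + V w t)‖ ≤ _
    rw [add_sub_add_left_eq_sub]
    exact hV z w t
  obtain ⟨z, hz, -⟩ := hΦ.exists_fixedPoint 0 (edist_ne_top _ _)
  refine ⟨z, z.continuous, fun t hst => ?_⟩
  have hzt : f (max t s) + V z t = z t := DFunLike.congr_fun hz.eq t
  simpa only [V, max_eq_left hst] using hzt.symm

/-- In terms of `z = exp(-2 ∫ ψ) y` the kernel becomes a contraction. -/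
theorem exists_volterra_solution (hk : Continuous fun p : ℝ × ℝ × E => k p.1 p.2.1 p.2.2)
    (hk0 : ∀ t u, k t u 0 = 0) {ψ : ℝ → ℝ} (hψ : Continuous ψ) (hψ0 : ∀ u, 0 ≤ ψ u)
    (hkψ : ∀ t u x x', ‖k t u x - k t u x'‖ ≤ ψ u * ‖x - x'‖)
    (hf : Continuous f) {F : ℝ} (hfF : ∀ t, s ≤ t → ‖f t‖ ≤ F) :
    ∃ y : ℝ → E, Continuous y ∧ ∀ t, s ≤ t → y t = f t + ∫ u in s..t, k t u (y u) := by
  let φ (t : ℝ) : ℝ := ∫ u in s..t, 2 * ψ u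
  have hφ (t : ℝ) : HasDerivAt φ (2 * ψ t) t :=
    ((hψ.const_mul 2).integral_hasStrictDerivAt s t).hasDerivAt
  have hφc : Continuous φ := continuous_iff_continuousAt.2 fun t => (hφ t).continuousAt
  have hhalf (t : ℝ) : ∫ u in s..t, ψ u * Real.exp (φ u - φ t) ≤ (2⁻¹ : NNReal) := by
    have := integral_deriv_mul_exp_sub_le_one hφ (hψ.const_mul 2) s t
    simp only [mul_assoc, intervalIntegral.integral_const_mul] at this
    push_cast
    linarith
  have hbound (t : ℝ) (hst : s ≤ t) : ‖Real.exp (-φ t) • f t‖ ≤ F := by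
    have hφ0 : 0 ≤ φ t := intervalIntegral.integral_nonneg hst fun u _ => by
      have := hψ0 u; positivity
    rw [norm_smul, Real.norm_of_nonneg (Real.exp_nonneg _)]
    exact (mul_le_of_le_one_left (norm_nonneg _) (Real.exp_le_one_iff.2 (by linarith))).trans
      (hfF t hst)
  obtain ⟨z, hzc, hz⟩ := exists_volterra_solution_of_contraction (s := s)
    (k := fun t u x => Real.exp (-φ t) • k t u (Real.exp (φ u) • x))
    ((by fun_prop : Continuous fun p : ℝ × ℝ × E => Real.exp (-φ p.1)).smul
      (hk.comp (by fun_prop : Continuous fun p : ℝ × ℝ × E =>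
        (p.1, p.2.1, Real.exp (φ p.2.1) • p.2.2))))
    (by simp [hk0]) (fun t u => norm_exp_smul_sub_le (hkψ t u) _ _) (fun t => by fun_prop)
    (fun t u => mul_nonneg (hψ0 u) (Real.exp_nonneg _)) (by norm_num) (fun t _ => hhalf t)
    (by fun_prop) hbound
  refine ⟨fun t => Real.exp (φ t) • z t, by fun_prop, fun t hst => ?_⟩
  simp only [hz t hst, intervalIntegral.integral_smul]
  rw [← smul_add, smul_smul, ← Real.exp_add, add_neg_cancel, Real.exp_zero, one_smul]

theorem IsC0Semigroup.exists_isSolution {X : Type*} [NormedAddCommGroup X] [NormedSpace ℂ X]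
    [CompleteSpace X] {T B : ℝ → X →L[ℂ] X} (hT : IsC0Semigroup T) {C : ℝ}
    (hC : ∀ t, 0 ≤ t → ‖T t‖ ≤ C) (hB : Continuous B) (s : ℝ) (x : X) :
    ∃ y, IsSolution T B s y ∧ y s = x := by
  have hC0 : 0 ≤ C := (norm_nonneg _).trans (hC 0 le_rfl)
  have hCe (t : ℝ) : ‖Semigroups.extend T t‖ ≤ C := hC _ (le_max_right t 0)
  have hcont := hT.continuous_extend hC
  have hker (t u : ℝ) (z w : X) :
      ‖Semigroups.extend T (t - u) (B u z) - Semigroups.extend T (t - u) (B u w)‖ ≤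
        C * ‖B u‖ * ‖z - w‖ := by
    rw [← map_sub, ← map_sub, mul_assoc]
    exact ContinuousLinearMap.le_of_opNorm_le_of_le _ (hCe _) ((B u).le_opNorm _)
  obtain ⟨y, hyc, hy⟩ := exists_volterra_solution (s := s)
    (f := fun t => Semigroups.extend T (t - s) x)
    (k := fun t u z => Semigroups.extend T (t - u) (B u z))
    (hcont.comp (by fun_prop : Continuous fun p : ℝ × ℝ × X =>
      (p.1 - p.2.1, B p.2.1 p.2.2)))
    (by simp) (by fun_prop : Continuous fun u => C * ‖B u‖) (fun u => by positivity) hker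
    (hcont.comp (by fun_prop : Continuous fun t => (t - s, x)))
    fun t _ => (Semigroups.extend T (t - s)).le_of_opNorm_le (hCe _) x
  have hys : y s = x := by
    simpa only [sub_self, hT.extend.zero_apply, intervalIntegral.integral_same, add_zero]
      using hy s le_rfl
  refine ⟨y, isSolution_extend_iff.1 ⟨hyc.continuousOn, fun t hst => ?_⟩, hys⟩
  rw [hys]
  exact hy t hst

end Existence

end Semigroups

theorem mainTheorem4_general {X : Type*} [NormedAddCommGroup X] [NormedSpace ℂ X]
    [CompleteSpace X] (T : ℝ → X →L[ℂ] X) (A : X →ₗ.[ℂ] X)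
    (hT : Semigroups.IsC0Semigroup T) (hA : Semigroups.IsGenerator T A) :
    (∀ γ : ℝ → ℂ, ContDiffOn ℝ 1 γ (Icc 0 1) →
      Disjoint (Semigroups.trace γ) (Semigroups.spec A) →
      ∃ L : X →L[ℂ] X,
        (∀ x : X, ∃ hx : Semigroups.rieszProj A γ x ∈ A.domain,
          A ⟨Semigroups.rieszProj A γ x, hx⟩ = L x) ∧
        ∀ x : A.domain, Semigroups.rieszProj A γ (A x) = L x) ∧
    (Semigroups.IsAsympStable T (fun _ => 0) →
      ∃ ε > 0, ∃ h > 0, ∀ (P : X →L[ℂ] X) (B : ℝ → X →L[ℂ] X), Continuous B →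
        Semigroups.SmallAverages A P B h ε →
        (∀ (s : ℝ) (x : X), ∃ y : ℝ → X, Semigroups.IsSolution T B s y ∧ y s = x) ∧
          Semigroups.IsAsympStable T B) := by
  refine ⟨fun γ hγ hγA => ?_, fun hS => ?_⟩
  · have hγc : ContinuousOn γ (uIcc 0 1) := by
      rw [uIcc_of_le zero_le_one]
      exact hγ.continuousOn
    have hγ' := Semigroups.intervalIntegrable_deriv_of_contDiffOn hγ
    exact ⟨Semigroups.compRieszProj A γ, Semigroups.map_rieszProj hγc hγ' hγA,
      Semigroups.rieszProj_apply_map hγc hγ' hγA⟩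
  · obtain ⟨C, hC1, hC⟩ := hS.exists_norm_le hT
    obtain ⟨h, hh, hTh⟩ := hS.exists_norm_le_of_pos hT (by norm_num : (0 : ℝ) < 1 / 4)
    refine ⟨1 / (48 * C ^ 2 * h), by positivity, h, hh, fun P B hB H =>
      ⟨hT.exists_isSolution hC hB, H.isAsympStable hT hA hC hC1 hB hh hTh ?_⟩⟩
    field_simp
    norm_num

theorem mainTheorem4 {X : Type*} [NormedAddCommGroup X] [NormedSpace ℂ X] [CompleteSpace X]
    (T : ℝ → X →L[ℂ] X) (A : X →ₗ.[ℂ] X)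
    (hT : Semigroups.IsC0Semigroup T) (hA : Semigroups.IsGenerator T A) :
    -- `A P₁` is a bounded operator, `P₁ A = A P₁` on `D(A)`, so `P₁ A` is bounded as well
    (∀ (σ₁ : Set ℂ) (γ : ℝ → ℂ), Semigroups.IsSeparated A σ₁ γ →
      ∃ L : X →L[ℂ] X,
        (∀ x : X, ∃ hx : Semigroups.rieszProj A γ x ∈ A.domain,
          A ⟨Semigroups.rieszProj A γ x, hx⟩ = L x) ∧
        ∀ x : A.domain, Semigroups.rieszProj A γ (A x) = L x) ∧
    -- robustness of stability; `δ₀` and `h₀` depend neither on the decomposition nor on `B`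
    (Semigroups.IsAsympStable T (fun _ => 0) →
      ∀ K α μ M : ℝ, α < μ →
      ∃ δ₀ > 0, ∃ h₀ > 0, ∀ δ h : ℝ, 0 < δ → δ ≤ δ₀ → h₀ ≤ h →
      ∀ (σ₁ : Set ℂ) (γ : ℝ → ℂ) (P₁ P₂ : X →L[ℂ] X) (B : ℝ → X →L[ℂ] X),
        Semigroups.IsSeparated A σ₁ γ →
        P₁ = Semigroups.rieszProj A γ →
        P₂ = ContinuousLinearMap.id ℂ X - P₁ →
        (∀ t, 0 ≤ t → ‖(T t).comp P₁‖ ≤ K * Real.exp (-α * t)) →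
        (∀ t, 0 ≤ t → ‖(T t).comp P₂‖ ≤ K * Real.exp (-μ * t)) →
        Continuous B →
        (∀ t, ‖B t‖ ≤ M) →
        (∀ t, ‖P₂.comp (B t)‖ ≤ M * δ) →
        (∀ t u, t ≤ u → u ≤ t + h →
          ‖(P₁.comp (Semigroups.primitive B t u)).comp (B u)‖ ≤ M * δ) →
        (∀ t u, t ≤ u → u ≤ t + h →
          Semigroups.NormCompLeftLE A (P₁.comp (Semigroups.primitive B t u)) (M * δ)) →
        (∀ t u, t ≤ u → u ≤ t + h →
          Semigroups.NormCompRightLE A (P₁.comp (Semigroups.primitive B t u)) (M * δ)) →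
        (∀ (s : ℝ) (x : X), ∃ y : ℝ → X, Semigroups.IsSolution T B s y ∧ y s = x) ∧
          Semigroups.IsAsympStable T B) := by
  obtain ⟨hRiesz, hStable⟩ := mainTheorem4_general T A hT hA
  refine ⟨fun σ₁ γ hsep => hRiesz γ hsep.curve.contDiffOn hsep.disjoint_trace_spec,
    fun hS K α μ M _ => ?_⟩
  obtain ⟨ε, hε, h₀, hh₀, hrobust⟩ := hStable hS
  refine ⟨ε / (|M| + 1), by positivity, h₀, hh₀, ?_⟩
  intro δ h hδ hδε hh σ₁ γ P₁ P₂ B _ _ hP₂ _ _ hB _ hP₂B hcomp hAC hCA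
  have hMδ : M * δ ≤ ε := by
    have := (le_div_iff₀ (by positivity)).1 hδε
    nlinarith [le_abs_self M]
  subst hP₂
  exact hrobust P₁ B hB (Semigroups.SmallAverages.mono ⟨hP₂B, hcomp, hAC, hCA⟩ hh hMδ)
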